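/- Let $p$ be a prime, let $r\ge 1$, and let $e_1,\dots,e_r\in(\mathbb Z/p)^{p-1}$ be linearly independent vectors over $\mathbb Z/p$, with coordinates $e_i=(e_{i,0},\dots,e_{i,p-2})$. Let $X=\mathbb Z/p$, $G=(\mathbb Z/p)^r$ with standard basis $v_1,\dots,v_r$, and $H=\mathbb Z/p$. For $0\le k\le p-2$ let $\Phi(k)\colon G\to H$ be the homomorphism with $\Phi(k)(v_i)=e_{i,k}$ for all $i$, and let $\Phi(p-1)$ be the identity automorphism of $G$. Let $H$ and $G$ act on the set $X^*$ of finite words over $X$ by fixing the empty word and by $$h(xw)=(h+x)\,w,\qquad g(xw)=x\,\bigl(\Phi(x)(g)\bigr)(w)\qquad(h\in H,\ g\in G,\ x\in X,\ w\in X^*),$$ where $\Phi(x)(g)$ is an element of $G$ if $x=p-1$ and of $H$ otherwise. The \emph{multi-edge spinal group} $\mathfrak G$ of $e_1,\dots,e_r$ is the group of permutations of $X^*$ generated by these permutations. It is self-similar: for $g\in\mathfrak G$ and $x\in X$ there are unique $g(x)\in X$ and $g|_x\in\mathfrak G$ with $g(xw)=g(x)\,g|_x(w)$ for all $w\in X^*$.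 For a field $K$, the \emph{Nekrashevych algebra} $N_K(\mathfrak G)$ is the unital associative $*$-algebra over $K$ (with $K$-linear involution) generated by the set $X\sqcup\mathfrak G$ subject to the relations: $g^*=g^{-1}$, the product $g\cdot h$ of generators equals the generator $gh$, and the identity element of $\mathfrak G$ equals the unit $1$ (for $g,h\in\mathfrak G$); $g\,x=g(x)\,g|_x$ (for $g\in\mathfrak G$, $x\in X$); $y^*x=\delta_{x,y}$ (for $x,y\in X$); and $\sum_{x\in X}xx^*=1$. Then: 1. if $r=1$, then $N_K(\mathfrak G)$ is a simple ring for every field $K$; 2. if $r\ge 2$, then $N_K(\mathfrak G)$ is not simple for any field $K$. -/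

import Mathlib

/-! ### Self-similar groups -/

/-- A self-similar group over the alphabet `X`: a group of length-preserving permutations of the set
`List X` of words (equivalently, a group with a faithful action on words by length-preserving
permutations) such that for all `g` in the group and `x ∈ X` there are a letter `g(x)` and an
element `g|_x` of the group with `g(xw) = g(x) g|_x(w)` for all words `w`. -/
structure SelfSimilarGroup (X : Type*) where
  carrier : Subgroup (Equiv.Perm (List X))
  length_apply : ∀ g ∈ carrier, ∀ w : List X, (g w).length = w.length
  exists_section : ∀ g ∈ carrier, ∀ x : X, ∃ y : X, ∃ h ∈ carrier,
    ∀ w : List X, g (x :: w) = y :: h w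

namespace SelfSimilarGroup

theorem perm_apply_inv {α : Type*} (a : Equiv.Perm α) (w : α) : a (a⁻¹ w) = w :=
  a.apply_symm_apply w

/-- The letter `g(x)`. -/
noncomputable def letter {X : Type*} (S : SelfSimilarGroup X) (g : S.carrier) (x : X) : X :=
  (S.exists_section g g.2 x).choose

/-- The section `g|_x`. -/
noncomputable def sect {X : Type*} (S : SelfSimilarGroup X) (g : S.carrier) (x : X) : S.carrier :=
  ⟨(S.exists_section g g.2 x).choose_spec.choose,
    (S.exists_section g g.2 x).choose_spec.choose_spec.1⟩

/-- The defining property of the letter `g(x)` and the section `g|_x`, which determines both. -/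
theorem apply_cons {X : Type*} (S : SelfSimilarGroup X) (g : S.carrier) (x : X) (w : List X) :
    (g : Equiv.Perm (List X)) (x :: w)
      = S.letter g x :: (S.sect g x : Equiv.Perm (List X)) w :=
  (S.exists_section g g.2 x).choose_spec.choose_spec.2 w

/-- The group generated by a set `A` of length-preserving permutations of words that is closed under
taking sections (an automaton) is self-similar. -/
def ofAutomaton {X : Type*} (A : Set (Equiv.Perm (List X)))
    (hlen : ∀ a ∈ A, ∀ w : List X, (a w).length = w.length)
    (hsec : ∀ a ∈ A, ∀ x : X, ∃ y : X, ∃ b ∈ A, ∀ w : List X, a (x :: w) = y :: b w) :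
    SelfSimilarGroup X where
  carrier := Subgroup.closure A
  length_apply := by
    intro g hg
    induction hg using Subgroup.closure_induction with
    | mem a ha => exact hlen a ha
    | one => intro w; rfl
    | mul a b _ _ iha ihb => intro w; rw [Equiv.Perm.mul_apply, iha, ihb]
    | inv a _ iha =>
      intro w
      have h := iha (a⁻¹ w)
      rw [perm_apply_inv] at h
      exact h.symm
  exists_section := by
    intro g hg
    have key : (∀ w : List X, (g w).length = w.length) ∧ ∀ x : X, ∃ y : X,
        ∃ h ∈ Subgroup.closure A, ∀ w : List X, g (x :: w) = y :: h w := by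
      induction hg using Subgroup.closure_induction with
      | mem a ha =>
        refine ⟨hlen a ha, fun x => ?_⟩
        obtain ⟨y, b, hb, h⟩ := hsec a ha x
        exact ⟨y, b, Subgroup.subset_closure hb, h⟩
      | one => exact ⟨fun w => rfl, fun x => ⟨x, 1, one_mem _, fun w => rfl⟩⟩
      | mul a b _ _ iha ihb =>
        refine ⟨fun w => by rw [Equiv.Perm.mul_apply, iha.1, ihb.1], fun x => ?_⟩
        obtain ⟨y, b', hb', hb⟩ := ihb.2 x
        obtain ⟨z, a', ha', ha⟩ := iha.2 y
        exact ⟨z, a' * b', mul_mem ha' hb', fun w => by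
          rw [Equiv.Perm.mul_apply, hb, ha, Equiv.Perm.mul_apply]⟩
      | inv a _ iha =>
        have hl : ∀ w : List X, (a⁻¹ w).length = w.length := by
          intro w
          have h := iha.1 (a⁻¹ w)
          rw [perm_apply_inv] at h
          exact h.symm
        refine ⟨hl, fun x => ?_⟩
        obtain ⟨z, hz⟩ := List.length_eq_one_iff.1 (hl [x])
        obtain ⟨y, b, hb, h⟩ := iha.2 z
        have hx : x = y := by
          have h1 := h []
          rw [← hz, perm_apply_inv] at h1
          exact (List.cons.inj h1).1
        subst hx
        refine ⟨z, b⁻¹, inv_mem hb, fun w => ?_⟩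
        rw [Equiv.Perm.inv_eq_iff_eq, h, perm_apply_inv]
    exact key.2

end SelfSimilarGroup

/-! ### Nekrashevych algebras -/

/-- Generators of the Nekrashevych algebra: `x` and `x*` for the letters `x`, and the group elements
`g` (the generator `g*` is `g⁻¹`). -/
inductive NekrashevychGen {X : Type*} (S : SelfSimilarGroup X)
  | letter (x : X)
  | letterStar (x : X)
  | elt (g : S.carrier)

open NekrashevychGen FreeAlgebra in
/-- Defining relations of the Nekrashevych algebra as a unital algebra. The set of relations is
closed under the involution with `x ↦ x*` and `g ↦ g⁻¹`. -/
inductive NekrashevychRel (K : Type*) [Field K] {X : Type*} [Fintype X] (S : SelfSimilarGroup X) :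
    FreeAlgebra K (NekrashevychGen S) → FreeAlgebra K (NekrashevychGen S) → Prop
  | one : NekrashevychRel K S (ι K (elt 1)) 1
  | mul (g h : S.carrier) :
      NekrashevychRel K S (ι K (elt g) * ι K (elt h)) (ι K (elt (g * h)))
  | ss (g : S.carrier) (x : X) :
      NekrashevychRel K S (ι K (elt g) * ι K (letter x))
        (ι K (letter (S.letter g x)) * ι K (elt (S.sect g x)))
  | ss_star (g : S.carrier) (x : X) :
      NekrashevychRel K S (ι K (letterStar x) * ι K (elt g⁻¹))
        (ι K (elt (S.sect g x)⁻¹) * ι K (letterStar (S.letter g x)))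
  | ck1_same (x : X) :
      NekrashevychRel K S (ι K (letterStar x) * ι K (letter x)) 1
  | ck1_ne (x y : X) (h : x ≠ y) :
      NekrashevychRel K S (ι K (letterStar y) * ι K (letter x)) 0
  | ck2 :
      NekrashevychRel K S (∑ x : X, ι K (letter x) * ι K (letterStar x)) 1

/-- The Nekrashevych algebra of a self-similar group over a finite alphabet, with coefficients in the
field `K`. -/
abbrev NekrashevychAlgebra (K : Type*) [Field K] {X : Type*} [Fintype X]
    (S : SelfSimilarGroup X) : Type _ :=
  RingQuot (NekrashevychRel K S)

/-! ### Multispinal groups -/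

/-- The data defining a multispinal group over the alphabet `X`: a free action of `H` on `X` and a map
`Φ : X → Aut(G) ∪ Hom(G, H)` (disjoint union) satisfying the conditions (S1), (S2), (S3). -/
structure MultispinalData (G H X : Type*) [Group G] [Finite G] [Group H] [Finite H] [Finite X]
    [MulAction H X] where
  Φ : X → MulAut G ⊕ (G →* H)
  free : ∀ (h : H) (x : X), h • x = x → h = 1
  exists_aut : ∃ x α, Φ x = Sum.inl α
  exists_hom : ∃ x l, Φ x = Sum.inr l
  /-- The kernels of the homomorphisms `l ∘ α`, with `l` a homomorphism in the image of `Φ` and `α` in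
  the group generated by the automorphisms in the image of `Φ`, intersect trivially. -/
  separates : ∀ g : G,
    (∀ (l : G →* H) (α : MulAut G), Sum.inr l ∈ Set.range Φ →
      α ∈ Subgroup.closure {β : MulAut G | Sum.inl β ∈ Set.range Φ} → l (α g) = 1) → g = 1

namespace MultispinalData

section

variable {H X : Type*} [Group H] [MulAction H X]

/-- The action of a state `h ∈ H` on words: `h(xw) = h(x) w`. -/
def actH (h : H) : List X → List X
  | [] => []
  | x :: w => (h • x) :: w

theorem actH_one (w : List X) : actH (1 : H) w = w := by
  cases w <;> simp [actH]

theorem actH_mul (h k : H) (w : List X) : actH (h * k) w = actH h (actH k w) := by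
  cases w <;> simp [actH, mul_smul]

theorem length_actH (h : H) (w : List X) : (actH h w).length = w.length := by
  cases w <;> simp [actH]

/-- The state `h ∈ H` as a permutation of words. -/
def permH (h : H) : Equiv.Perm (List X) where
  toFun := actH h
  invFun := actH h⁻¹
  left_inv w := by rw [← actH_mul, inv_mul_cancel, actH_one]
  right_inv w := by rw [← actH_mul, mul_inv_cancel, actH_one]

end

section

variable {G H X : Type*} [Group G] [Finite G] [Group H] [Finite H] [Finite X] [MulAction H X]

/-- The action of a state `g ∈ G` on words: `g(xw) = x Φ(x)(g)(w)`. -/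
def actG (D : MultispinalData G H X) : G → List X → List X
  | _, [] => []
  | g, x :: w => x :: (match D.Φ x with
      | Sum.inl α => D.actG (α g) w
      | Sum.inr l => actH (l g) w)

theorem actG_one (D : MultispinalData G H X) (w : List X) : D.actG 1 w = w := by
  induction w with
  | nil => simp [actG]
  | cons x w ih => cases hx : D.Φ x <;> simp [actG, hx, ih, actH_one]

theorem actG_mul (D : MultispinalData G H X) (g k : G) (w : List X) :
    D.actG (g * k) w = D.actG g (D.actG k w) := by
  induction w generalizing g k with
  | nil => simp [actG]
  | cons x w ih => cases hx : D.Φ x <;> simp [actG, hx, ih, actH_mul]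

theorem length_actG (D : MultispinalData G H X) (g : G) (w : List X) :
    (D.actG g w).length = w.length := by
  induction w generalizing g with
  | nil => simp [actG]
  | cons x w ih => cases hx : D.Φ x <;> simp [actG, hx, ih, length_actH]

/-- The state `g ∈ G` as a permutation of words. -/
def permG (D : MultispinalData G H X) (g : G) : Equiv.Perm (List X) where
  toFun := D.actG g
  invFun := D.actG g⁻¹
  left_inv w := by rw [← actG_mul, inv_mul_cancel, actG_one]
  right_inv w := by rw [← actG_mul, mul_inv_cancel, actG_one]

/-- The multispinal group: the self-similar group generated by the states `g ∈ G` and `h ∈ H`. -/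
def group (D : MultispinalData G H X) : SelfSimilarGroup X :=
  SelfSimilarGroup.ofAutomaton (Set.range D.permG ∪ Set.range (permH (H := H)))
    (by
      rintro _ (⟨g, rfl⟩ | ⟨h, rfl⟩) w
      · exact D.length_actG g w
      · exact length_actH h w)
    (by
      rintro _ (⟨g, rfl⟩ | ⟨h, rfl⟩) x
      · cases hx : D.Φ x with
        | inl α =>
          exact ⟨x, D.permG (α g), Or.inl ⟨_, rfl⟩, fun w => by simp [permG, actG, hx]⟩
        | inr l =>
          exact ⟨x, permH (l g), Or.inr ⟨_, rfl⟩, fun w => by simp [permG, permH, actG, hx]⟩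
      · exact ⟨h • x, permH 1, Or.inr ⟨_, rfl⟩, fun w =>
          congrArg (List.cons (h • x)) (actH_one (H := H) w).symm⟩)

end

end MultispinalData

/-! ### Multi-edge spinal groups -/

/-- The homomorphism `(ℤ/p)^r → ℤ/p` that sends the `i`-th standard basis vector to the `k`-th
coordinate of `e i`. -/
def multiEdgeHom {p r : ℕ} (e : Fin r → Fin (p - 1) → ZMod p) (k : Fin (p - 1)) :
    Multiplicative (Fin r → ZMod p) →* Multiplicative (ZMod p) :=
  AddMonoidHom.toMultiplicative
    { toFun := fun v => ∑ i, v i * e i k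
      map_zero' := by simp
      map_add' := fun v w => by simp [add_mul, Finset.sum_add_distrib] }

/-- The multispinal data of a multi-edge spinal group: `X = ℤ/p`, `G = (ℤ/p)^r`, `H = ℤ/p` acting on
`X` by translations, `Φ(p-1)` is the identity automorphism of `G`, and `Φ(k) : G → H` for
`0 ≤ k ≤ p-2` sends the `i`-th standard basis vector to the `k`-th coordinate of `e i`. -/
def multiEdgeData {p r : ℕ} [Fact p.Prime] (e : Fin r → Fin (p - 1) → ZMod p)
    (he : LinearIndependent (ZMod p) e) :
    MultispinalData (Multiplicative (Fin r → ZMod p)) (Multiplicative (ZMod p)) (ZMod p) where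
  Φ x := if h : x.val < p - 1 then Sum.inr (multiEdgeHom e ⟨x.val, h⟩) else Sum.inl 1
  free h x hx := by
    have h1 : h.toAdd + x = x := hx
    exact Multiplicative.toAdd.injective (by simpa using h1)
  exists_aut := by
    have hp := (Fact.out : p.Prime).two_le
    refine ⟨((p - 1 : ℕ) : ZMod p), 1, dif_neg ?_⟩
    rw [ZMod.val_natCast, Nat.mod_eq_of_lt (by omega)]
    exact lt_irrefl _
  exists_hom := by
    have hp := (Fact.out : p.Prime).two_le
    exact ⟨0, _, dif_pos (by rw [ZMod.val_zero]; omega)⟩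
  separates g hg := by
    have hp := (Fact.out : p.Prime).two_le
    have key : ∑ i, g.toAdd i • e i = 0 := by
      funext k
      have hk : ((k : ℕ) : ZMod p).val = k := by
        rw [ZMod.val_natCast, Nat.mod_eq_of_lt (by omega)]
      have h1 := hg (multiEdgeHom e k) 1
        ⟨((k : ℕ) : ZMod p), by simp [hk]⟩ (one_mem _)
      have h2 : ∑ i, g.toAdd i * e i k = 0 := h1
      simpa [Finset.sum_apply] using h2
    apply Multiplicative.toAdd.injective
    funext i
    exact Fintype.linearIndependent_iff.1 he _ key i

/-- The multi-edge spinal group of the linearly independent vectors `e 0, …, e (r - 1)`. -/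
def multiEdgeSpinalGroup {p r : ℕ} [Fact p.Prime] (e : Fin r → Fin (p - 1) → ZMod p)
    (he : LinearIndependent (ZMod p) e) : SelfSimilarGroup (ZMod p) :=
  (multiEdgeData e he).group

/-! The set `N = G ∪ H` is a nucleus that contracts in one step: it is closed under sections, and
the sections of a product of two of its elements are again in `N`. Hence, for every `a` in the
algebra and all long words `v`, the product `a v` is a combination of elements `u s` with `u` a word
and `s ∈ N` (`mem_eventualSpan`).

If `r = 1`, some `Φ(x) : G → H` is injective. At the word `xx` all elements of `N` have trivial
sections, and they are told apart by their values there. Given a nonzero `a` in an ideal, choose `v`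
with `a v ≠ 0`; then `a v xx` is a nonzero combination of words, and such a combination generates
the unit ideal (`exists_mul_linearCombination_mul`).

If `r ≥ 2`, then `(p-1) p < p^r`, so a dimension count gives a nonzero `c ∈ K[G]` that every `Φ(k)`
with `k ≤ p-2` sends to zero in `K[H]`. By induction on words, `c` acts as zero on functions on
words. It is nevertheless nonzero in the algebra: along the words `(p-1)^n` each `g ∈ G` is its own
section, and a second representation, on functions of a word and a group element, detects this. The
kernel of the first representation is thus a proper nonzero ideal. -/

namespace SelfSimilarGroup

variable {X : Type*} (S : SelfSimilarGroup X)

theorem letter_sect_unique {g : S.carrier} {x y : X} {h : Equiv.Perm (List X)}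
    (H : ∀ w : List X, (g : Equiv.Perm (List X)) (x :: w) = y :: h w) :
    S.letter g x = y ∧ (S.sect g x : Equiv.Perm (List X)) = h := by
  have key : ∀ w, S.letter g x :: (S.sect g x : Equiv.Perm (List X)) w = y :: h w := fun w => by
    rw [← S.apply_cons, H]
  exact ⟨(List.cons.inj (key [])).1, Equiv.ext fun w => (List.cons.inj (key w)).2⟩

theorem letter_one (x : X) : S.letter 1 x = x :=
  (S.letter_sect_unique (h := 1) fun _ => rfl).1

theorem sect_one (x : X) : S.sect 1 x = 1 :=
  Subtype.ext (S.letter_sect_unique (h := 1) fun _ => rfl).2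

theorem letter_sect_mul (g h : S.carrier) (x : X) :
    S.letter (g * h) x = S.letter g (S.letter h x) ∧
      ((S.sect (g * h) x : S.carrier) : Equiv.Perm (List X)) =
        (S.sect g (S.letter h x) * S.sect h x : S.carrier) :=
  S.letter_sect_unique fun w => by
    simp only [Subgroup.coe_mul, Equiv.Perm.mul_apply, S.apply_cons]

theorem letter_mul (g h : S.carrier) (x : X) :
    S.letter (g * h) x = S.letter g (S.letter h x) :=
  (S.letter_sect_mul g h x).1

theorem sect_mul (g h : S.carrier) (x : X) :
    S.sect (g * h) x = S.sect g (S.letter h x) * S.sect h x :=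
  Subtype.ext (S.letter_sect_mul g h x).2

/-! ### The generators of the Nekrashevych algebra -/

section Algebra

variable (K : Type*) [Field K] [Fintype X]

/-- The generator `x`. -/
noncomputable def algLetter (x : X) : NekrashevychAlgebra K S :=
  RingQuot.mkAlgHom K (NekrashevychRel K S) (FreeAlgebra.ι K (.letter x))

/-- The generator `x*`. -/
noncomputable def algStar (x : X) : NekrashevychAlgebra K S :=
  RingQuot.mkAlgHom K (NekrashevychRel K S) (FreeAlgebra.ι K (.letterStar x))

/-- The group elements in the Nekrashevych algebra. -/
noncomputable def algElt : S.carrier →* NekrashevychAlgebra K S where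
  toFun g := RingQuot.mkAlgHom K (NekrashevychRel K S) (FreeAlgebra.ι K (.elt g))
  map_one' := by
    rw [RingQuot.mkAlgHom_rel K (NekrashevychRel.one (K := K) (S := S)), map_one]
  map_mul' g h := by
    rw [← RingQuot.mkAlgHom_rel K (NekrashevychRel.mul (K := K) (S := S) g h), map_mul]

theorem algElt_mul_algLetter (g : S.carrier) (x : X) :
    S.algElt K g * S.algLetter K x = S.algLetter K (S.letter g x) * S.algElt K (S.sect g x) := by
  have h := RingQuot.mkAlgHom_rel K (NekrashevychRel.ss (K := K) (S := S) g x)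
  rwa [map_mul, map_mul] at h

theorem algStar_mul_algLetter_same (x : X) : S.algStar K x * S.algLetter K x = 1 := by
  have h := RingQuot.mkAlgHom_rel K (NekrashevychRel.ck1_same (K := K) (S := S) x)
  rwa [map_mul, map_one] at h

theorem algStar_mul_algLetter_ne {x y : X} (hxy : x ≠ y) :
    S.algStar K y * S.algLetter K x = 0 := by
  have h := RingQuot.mkAlgHom_rel K (NekrashevychRel.ck1_ne (K := K) (S := S) x y hxy)
  rwa [map_mul, map_zero] at h

theorem sum_algLetter_mul_algStar : ∑ x, S.algLetter K x * S.algStar K x = 1 := by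
  have h := RingQuot.mkAlgHom_rel K (NekrashevychRel.ck2 (K := K) (S := S))
  simp only [map_sum, map_mul, map_one] at h
  exact h

/-- A subalgebra containing all generators is everything. -/
theorem subalgebra_eq_top (B : Subalgebra K (NekrashevychAlgebra K S))
    (hl : ∀ x, S.algLetter K x ∈ B) (hs : ∀ x, S.algStar K x ∈ B)
    (hg : ∀ g, S.algElt K g ∈ B) : B = ⊤ := by
  refine top_le_iff.1 fun a _ => ?_
  obtain ⟨b, rfl⟩ := RingQuot.mkAlgHom_surjective K (NekrashevychRel K S) a
  induction b using FreeAlgebra.induction with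
  | grade0 r => rw [AlgHom.commutes]; exact B.algebraMap_mem r
  | grade1 x =>
    cases x with
    | letter x => exact hl x
    | letterStar x => exact hs x
    | elt g => exact hg g
  | mul a b ha hb => rw [map_mul]; exact B.mul_mem (ha trivial) (hb trivial)
  | add a b ha hb => rw [map_add]; exact B.add_mem (ha trivial) (hb trivial)

/-- The product of the letters of a word. -/
noncomputable def algWord (u : List X) : NekrashevychAlgebra K S :=
  (u.map (S.algLetter K)).prod

/-- The adjoint of `algWord`. -/
noncomputable def algWordStar : List X → NekrashevychAlgebra K S
  | [] => 1
  | x :: u => algWordStar u * S.algStar K x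

theorem algWord_nil : S.algWord K [] = 1 := rfl

theorem algWord_cons (x : X) (u : List X) :
    S.algWord K (x :: u) = S.algLetter K x * S.algWord K u := by
  simp [algWord]

theorem algWord_append (u v : List X) :
    S.algWord K (u ++ v) = S.algWord K u * S.algWord K v := by
  simp [algWord]

theorem algWordStar_mul_algWord_same (u : List X) :
    S.algWordStar K u * S.algWord K u = 1 := by
  induction u with
  | nil => simp [algWordStar, algWord]
  | cons x u ih =>
    rw [algWordStar, algWord_cons, mul_assoc, ← mul_assoc (S.algStar K x),
      algStar_mul_algLetter_same, one_mul, ih]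

theorem algWordStar_mul_algWord_eq_zero {u w : List X} (hl : u.length ≤ w.length)
    (h : ¬ u <+: w) : S.algWordStar K u * S.algWord K w = 0 := by
  induction u generalizing w with
  | nil => exact absurd List.nil_prefix h
  | cons x u ih =>
    cases w with
    | nil => simp at hl
    | cons y w =>
      rw [algWordStar, algWord_cons, mul_assoc, ← mul_assoc (S.algStar K x)]
      by_cases hxy : y = x
      · subst hxy
        rw [algStar_mul_algLetter_same, one_mul]
        exact ih (by simpa using hl) fun h' => h (by simpa using h')
      · rw [algStar_mul_algLetter_ne S K hxy, zero_mul, mul_zero]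

/-- Iterating `∑ x x* = 1` writes `a` as the sum of `a v v*` over the words `v` of length `n`. -/
theorem eq_zero_of_mul_algWord (n : ℕ) {a : NekrashevychAlgebra K S}
    (h : ∀ v : List X, v.length = n → a * S.algWord K v = 0) : a = 0 := by
  induction n with
  | zero => simpa [algWord_nil] using h [] rfl
  | succ n ih =>
    refine ih fun v hv => ?_
    rw [← mul_one (a * _), ← sum_algLetter_mul_algStar, Finset.mul_sum]
    refine Finset.sum_eq_zero fun x _ => ?_
    have := h (v ++ [x]) (by simp [hv])
    rw [algWord_append, algWord_cons, algWord_nil, mul_one] at this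
    rw [← mul_assoc, mul_assoc a, this, zero_mul]

/-- If the section of `s` at `v` is trivial, then `s v = s(v)`. -/
theorem algElt_mul_algWord (v : List X) (s : S.carrier)
    (h : ∀ w, (s : Equiv.Perm (List X)) (v ++ w) = (s : Equiv.Perm (List X)) v ++ w) :
    S.algElt K s * S.algWord K v = S.algWord K ((s : Equiv.Perm (List X)) v) := by
  induction v generalizing s with
  | nil =>
    have h0 : (s : Equiv.Perm (List X)) [] = [] := List.length_eq_zero_iff.1 (S.length_apply s s.2 [])
    have : s = 1 := Subtype.ext (Equiv.ext fun w => by simpa [h0] using h w)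
    subst this
    simp [algWord]
  | cons x v ih =>
    rw [algWord_cons, ← mul_assoc, algElt_mul_algLetter, mul_assoc, ih, S.apply_cons, algWord_cons]
    intro w
    have := h w
    rw [List.cons_append, S.apply_cons, S.apply_cons, List.cons_append] at this
    exact (List.cons.inj this).2

/-- A nonempty linear combination of words generates the unit ideal. -/
theorem exists_mul_linearCombination_mul [Nontrivial X] {c : List X →₀ K} (hc : c ≠ 0) :
    ∃ k : K, k ≠ 0 ∧ ∃ a b : NekrashevychAlgebra K S,
      a * Finsupp.linearCombination K (S.algWord K) c * b = algebraMap K _ k := by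
  classical
  obtain ⟨x, y, hxy⟩ := exists_pair_ne X
  obtain ⟨u, hu, hmin⟩ := c.support.exists_min_image List.length (Finsupp.support_nonempty_iff.2 hc)
  set L := c.support.sup List.length
  -- With this `w`, `u w` is not a prefix of `u t w` when `1 ≤ |t| ≤ L`: position `L` of `w` holds
  -- `y`, while position `L` of `t w` falls in the block of letters `x`. So `(u w)*` kills every
  -- term except that of the shortest word `u`.
  set w := List.replicate L x ++ [y] with hw
  refine ⟨c u, Finsupp.mem_support_iff.1 hu, S.algWordStar K (u ++ w), S.algWord K w, ?_⟩
  have key : ∀ v ∈ c.support, v ≠ u → ¬ (u ++ w) <+: (v ++ w) := by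
    intro v hv hvu hp
    obtain ⟨t, rfl⟩ : u <+: v := List.prefix_of_prefix_length_le
      ((List.prefix_append u w).trans hp) (List.prefix_append v w) (hmin v hv)
    rw [List.append_assoc, List.prefix_append_right_inj] at hp
    have ht : 0 < t.length := List.length_pos_iff.2 fun h => hvu (by simp [h])
    have htL : t.length ≤ L := by
      have := Finset.le_sup (f := List.length) hv
      rw [List.length_append] at this
      omega
    have hL : w[L]? = some y := by simp [hw]
    obtain ⟨z, hz⟩ := hp
    have h2 : (t ++ w)[L]? = some y := by
      rw [← hz, List.getElem?_append_left (by simp [hw]), hL]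
    rw [List.getElem?_append_right htL, hw, List.getElem?_append_left (by simp; omega),
      List.getElem?_replicate, if_pos (by omega)] at h2
    exact hxy (Option.some.inj h2)
  rw [Finsupp.linearCombination_apply, Finsupp.sum, Finset.mul_sum, Finset.sum_mul,
    Finset.sum_eq_single u]
  · rw [mul_smul_comm, smul_mul_assoc, mul_assoc, ← algWord_append, algWordStar_mul_algWord_same,
      Algebra.algebraMap_eq_smul_one]
  · intro v hv hvu
    rw [mul_smul_comm, smul_mul_assoc, mul_assoc, ← algWord_append,
      algWordStar_mul_algWord_eq_zero _ _ (by simpa using hmin v hv) (key v hv hvu), smul_zero]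
  · exact fun h => absurd hu h

end Algebra

/-! ### Representations on functions modulo functions supported on short words -/

section Rep

variable {Y : Type*} [MulAction S.carrier Y]

/-- The action of the group on pairs `(w, y)`, twisted by sections: `g(w, y) = (g(w), g|_w y)`. -/
noncomputable def pairAct : S.carrier → List X → Y → List X × Y
  | g, [], y => ([], g • y)
  | g, x :: w, y => (S.letter g x :: (pairAct (S.sect g x) w y).1, (pairAct (S.sect g x) w y).2)

theorem pairAct_one (w : List X) (y : Y) : S.pairAct 1 w y = (w, y) := by
  induction w with
  | nil => simp [pairAct]
  | cons x w ih => simp [pairAct, letter_one, sect_one, ih]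

theorem pairAct_mul (g h : S.carrier) (w : List X) (y : Y) :
    S.pairAct (g * h) w y = S.pairAct g (S.pairAct h w y).1 (S.pairAct h w y).2 := by
  induction w generalizing g h with
  | nil => simp [pairAct, mul_smul]
  | cons x w ih => simp [pairAct, letter_mul, sect_mul, ih]

theorem length_pairAct (g : S.carrier) (w : List X) (y : Y) :
    (S.pairAct g w y).1.length = w.length := by
  induction w generalizing g with
  | nil => simp [pairAct]
  | cons x w ih => simp [pairAct, ih]

end Rep

section Rep

variable (K : Type*) [Field K] (Y : Type*) [MulAction S.carrier Y]

/-- Functions that vanish on all pairs with a long first component. -/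
def shortSupport (X K Y : Type*) [Field K] : Submodule K (List X → Y → K) where
  carrier := {f | ∃ n : ℕ, ∀ w y, n ≤ w.length → f w y = 0}
  zero_mem' := ⟨0, fun _ _ _ => rfl⟩
  add_mem' := by
    rintro f g ⟨m, hm⟩ ⟨n, hn⟩
    exact ⟨max m n, fun w y h => by
      simp [hm w y (le_trans (le_max_left _ _) h), hn w y (le_trans (le_max_right _ _) h)]⟩
  smul_mem' := by
    rintro c f ⟨m, hm⟩
    exact ⟨m, fun w y h => by simp [hm w y h]⟩

open Classical in
/-- The operator that moves a function to the words starting with `x`. -/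
noncomputable def opLetter (x : X) : (List X → Y → K) →ₗ[K] (List X → Y → K) where
  toFun f w y := match w with
    | [] => 0
    | z :: w => if z = x then f w y else 0
  map_add' f g := by
    funext w y
    rcases w with _ | ⟨z, w⟩ <;> simp [ite_add_ite]
  map_smul' c f := by
    funext w y
    rcases w with _ | ⟨z, w⟩ <;> simp

/-- The operator that restricts a function to the words starting with `x`. -/
def opStar (x : X) : (List X → Y → K) →ₗ[K] (List X → Y → K) where
  toFun f w y := f (x :: w) y
  map_add' _ _ := rfl
  map_smul' _ _ := rfl

/-- The operator of a group element. -/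
noncomputable def opElt (g : S.carrier) : (List X → Y → K) →ₗ[K] (List X → Y → K) where
  toFun f w y := f (S.pairAct g⁻¹ w y).1 (S.pairAct g⁻¹ w y).2
  map_add' _ _ := rfl
  map_smul' _ _ := rfl

/-- The operators of the generators on functions modulo functions supported on short words. -/
noncomputable def opGen :
    NekrashevychGen S → Module.End K ((List X → Y → K) ⧸ shortSupport X K Y)
  | .letter x => (shortSupport X K Y).mapQ (shortSupport X K Y) (opLetter K Y x) (by
      rintro f ⟨n, hn⟩
      refine ⟨n + 1, fun w y h => ?_⟩
      rcases w with _ | ⟨z, w⟩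
      · simp at h
      · simp only [opLetter, LinearMap.coe_mk, AddHom.coe_mk]
        split_ifs
        · exact hn w y (by simpa using h)
        · rfl)
  | .letterStar x => (shortSupport X K Y).mapQ (shortSupport X K Y) (opStar K Y x) (by
      rintro f ⟨n, hn⟩
      exact ⟨n, fun w y h => hn _ _ (by simp; omega)⟩)
  | .elt g => (shortSupport X K Y).mapQ (shortSupport X K Y) (S.opElt K Y g) (by
      rintro f ⟨n, hn⟩
      exact ⟨n, fun w y h => hn _ _ (by rwa [length_pairAct])⟩)

theorem opGen_rel [Fintype X] (a b : FreeAlgebra K (NekrashevychGen S))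
    (h : NekrashevychRel K S a b) :
    FreeAlgebra.lift K (S.opGen K Y) a = FreeAlgebra.lift K (S.opGen K Y) b := by
  classical
  have hinv : ∀ (g : S.carrier) (x : X), S.letter g⁻¹ (S.letter g x) = x ∧
      S.sect g⁻¹ (S.letter g x) = (S.sect g x)⁻¹ := by
    intro g x
    rw [← letter_mul, inv_mul_cancel, letter_one, eq_inv_iff_mul_eq_one, ← sect_mul,
      inv_mul_cancel, sect_one]
    exact ⟨rfl, rfl⟩
  have hinv' : ∀ (g : S.carrier) (x z : X), S.letter g⁻¹ z = x ↔ z = S.letter g x := by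
    intro g x z
    constructor
    · rintro rfl
      rw [← letter_mul, mul_inv_cancel, letter_one]
    · rintro rfl
      exact (hinv g x).1
  refine Submodule.linearMap_qext _ (LinearMap.ext fun f => ?_)
  cases h with
  | one =>
    simp only [FreeAlgebra.lift_ι_apply, map_one, opGen, LinearMap.comp_apply,
      Submodule.mkQ_apply, Submodule.mapQ_apply, Module.End.one_apply]
    congr 1
    funext w y
    simp [opElt, pairAct_one]
  | mul g h =>
    simp only [FreeAlgebra.lift_ι_apply, map_mul, opGen, LinearMap.comp_apply,
      Submodule.mkQ_apply, Submodule.mapQ_apply, Module.End.mul_apply]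
    congr 1
    funext w y
    simp [opElt, pairAct_mul]
  | ss g x =>
    simp only [FreeAlgebra.lift_ι_apply, map_mul, opGen, LinearMap.comp_apply,
      Submodule.mkQ_apply, Submodule.mapQ_apply, Module.End.mul_apply]
    congr 1
    funext w y
    rcases w with _ | ⟨z, w⟩
    · simp [opElt, opLetter, pairAct]
    · simp only [opElt, opLetter, pairAct, LinearMap.coe_mk, AddHom.coe_mk, hinv']
      split_ifs with hz
      · subst hz
        rw [(hinv g x).2]
      · rfl
  | ss_star g x =>
    simp only [FreeAlgebra.lift_ι_apply, map_mul, opGen, LinearMap.comp_apply,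
      Submodule.mkQ_apply, Submodule.mapQ_apply, Module.End.mul_apply]
    -- Both sides unfold to `f` at `pairAct g (x :: w) y`, a double inverse of a permutation being
    -- definitionally the permutation.
    congr 1
  | ck1_same x =>
    simp only [FreeAlgebra.lift_ι_apply, map_mul, map_one, opGen, LinearMap.comp_apply,
      Submodule.mkQ_apply, Submodule.mapQ_apply, Module.End.mul_apply, Module.End.one_apply]
    congr 1
    funext w y
    simp [opLetter, opStar]
  | ck1_ne x y h =>
    simp only [FreeAlgebra.lift_ι_apply, map_mul, map_zero, opGen, LinearMap.comp_apply,
      Submodule.mkQ_apply, Submodule.mapQ_apply, Module.End.mul_apply, LinearMap.zero_apply]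
    rw [Submodule.Quotient.mk_eq_zero]
    refine ⟨0, fun w y' _ => ?_⟩
    simp [opLetter, opStar, h.symm]
  | ck2 =>
    simp only [FreeAlgebra.lift_ι_apply, map_sum, map_mul, map_one, opGen, LinearMap.comp_apply,
      LinearMap.sum_apply,
      Submodule.mkQ_apply, Submodule.mapQ_apply, Module.End.mul_apply, Module.End.one_apply]
    rw [← Submodule.mkQ_apply, ← sub_eq_zero]
    simp only [← Submodule.mkQ_apply, ← map_sum, ← map_sub]
    rw [Submodule.mkQ_apply, Submodule.Quotient.mk_eq_zero]
    -- `∑ x x*` kills the values at the empty word and is the identity elsewhere; the relation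
    -- therefore needs the quotient by short support.
    refine ⟨1, fun w y hw => ?_⟩
    rcases w with _ | ⟨z, w⟩
    · simp at hw
    · simp [opLetter, opStar, Finset.sum_apply]

/-- The representation of the Nekrashevych algebra given by a set with an action of the group. -/
noncomputable def rep [Fintype X] :
    NekrashevychAlgebra K S →ₐ[K] Module.End K ((List X → Y → K) ⧸ shortSupport X K Y) :=
  RingQuot.liftAlgHom K ⟨FreeAlgebra.lift K (S.opGen K Y), fun {a b} h => S.opGen_rel K Y a b h⟩

theorem rep_algElt [Fintype X] (g : S.carrier) (f : List X → Y → K) :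
    S.rep K Y (S.algElt K g) ((shortSupport X K Y).mkQ f) =
      (shortSupport X K Y).mkQ (S.opElt K Y g f) := by
  simp [rep, algElt, opGen]

theorem rep_sum_smul_algElt [Fintype X] {ι : Type*} [Fintype ι] (γ : ι → S.carrier) (c : ι → K)
    (f : List X → Y → K) :
    S.rep K Y (∑ i, c i • S.algElt K (γ i)) ((shortSupport X K Y).mkQ f) =
      (shortSupport X K Y).mkQ (∑ i, c i • S.opElt K Y (γ i) f) := by
  rw [map_sum, map_sum, LinearMap.sum_apply]
  refine Finset.sum_congr rfl fun i _ => ?_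
  rw [map_smul, map_smul, LinearMap.smul_apply, rep_algElt]

/-- The constant function `1` does not vanish on long words. Through `rep`, this makes the algebra
nontrivial. -/
theorem nontrivial_quotient_shortSupport [Nonempty X] [Nonempty Y] :
    Nontrivial ((List X → Y → K) ⧸ shortSupport X K Y) := by
  refine Submodule.Quotient.nontrivial_iff.2 fun h => ?_
  obtain ⟨n, hn⟩ : (fun _ _ => 1 : List X → Y → K) ∈ shortSupport X K Y := h ▸ trivial
  obtain ⟨x⟩ := ‹Nonempty X›
  obtain ⟨y⟩ := ‹Nonempty Y›
  exact one_ne_zero (hn (List.replicate n x) y (by simp))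

end Rep

end SelfSimilarGroup

/-! ### Criteria for simplicity and non-simplicity -/

namespace SelfSimilarGroup

section Simple

variable {X : Type*} [Fintype X] (S : SelfSimilarGroup X) (K : Type*) [Field K]

/-- The span of the products `u s` of a word and an element of `N`. -/
noncomputable def wordSpan (N : Set S.carrier) : Submodule K (NekrashevychAlgebra K S) :=
  Submodule.span K (Set.range fun us : List X × N => S.algWord K us.1 * S.algElt K us.2)

variable {S K} {N : Set S.carrier}

theorem mem_wordSpan (u : List X) {s : S.carrier} (hs : s ∈ N) :
    S.algWord K u * S.algElt K s ∈ S.wordSpan K N :=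
  Submodule.subset_span ⟨(u, ⟨s, hs⟩), rfl⟩

theorem map_mem_of_mem_wordSpan {P : Submodule K (NekrashevychAlgebra K S)}
    (f : NekrashevychAlgebra K S →ₗ[K] NekrashevychAlgebra K S)
    (h : ∀ u, ∀ s ∈ N, f (S.algWord K u * S.algElt K s) ∈ P) {a : NekrashevychAlgebra K S}
    (ha : a ∈ S.wordSpan K N) : f a ∈ P := by
  have : S.wordSpan K N ≤ P.comap f := by
    refine Submodule.span_le.2 ?_
    rintro _ ⟨us, rfl⟩
    exact h us.1 us.2 us.2.2
  exact this ha

theorem exists_algElt_mul_algWord (hsec : ∀ s ∈ N, ∀ x, S.sect s x ∈ N) (u : List X)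
    {s : S.carrier} (hs : s ∈ N) : ∃ u' : List X, ∃ t ∈ N,
      S.algElt K s * S.algWord K u = S.algWord K u' * S.algElt K t := by
  induction u generalizing s with
  | nil => exact ⟨[], s, hs, by simp [algWord]⟩
  | cons x u ih =>
    obtain ⟨u', t, ht, h⟩ := ih (hsec s hs x)
    exact ⟨S.letter s x :: u', t, ht, by
      rw [algWord_cons, algWord_cons, ← mul_assoc, algElt_mul_algLetter, mul_assoc, h, mul_assoc]⟩

theorem mul_algWord_mem_wordSpan (hsec : ∀ s ∈ N, ∀ x, S.sect s x ∈ N) (v : List X)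
    {a : NekrashevychAlgebra K S} (ha : a ∈ S.wordSpan K N) :
    a * S.algWord K v ∈ S.wordSpan K N := by
  refine map_mem_of_mem_wordSpan (LinearMap.mulRight K (S.algWord K v)) (fun u s hs => ?_) ha
  obtain ⟨v', t, ht, h⟩ := exists_algElt_mul_algWord (K := K) hsec v hs
  rw [LinearMap.mulRight_apply, mul_assoc, h, ← mul_assoc, ← algWord_append]
  exact mem_wordSpan _ ht

theorem algLetter_mul_mem_wordSpan (x : X) {a : NekrashevychAlgebra K S}
    (ha : a ∈ S.wordSpan K N) : S.algLetter K x * a ∈ S.wordSpan K N := by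
  refine map_mem_of_mem_wordSpan (LinearMap.mulLeft K (S.algLetter K x)) (fun u s hs => ?_) ha
  rw [LinearMap.mulLeft_apply, ← mul_assoc, ← algWord_cons]
  exact mem_wordSpan _ hs

/-- The letter `x` on the right moves past `s` and makes the word nonempty, so that `y*` always has
a letter to cancel or to annihilate. -/
theorem algStar_mul_mul_algLetter_mem_wordSpan (hsec : ∀ s ∈ N, ∀ x, S.sect s x ∈ N) (y x : X)
    {a : NekrashevychAlgebra K S} (ha : a ∈ S.wordSpan K N) :
    S.algStar K y * (a * S.algLetter K x) ∈ S.wordSpan K N := by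
  have key : ∀ (z : X) (u : List X) (s : S.carrier), s ∈ N →
      S.algStar K y * (S.algWord K (z :: u) * S.algElt K s) ∈ S.wordSpan K N := by
    intro z u s hs
    rw [algWord_cons, ← mul_assoc, ← mul_assoc]
    by_cases hzy : z = y
    · subst hzy
      rw [algStar_mul_algLetter_same, one_mul]
      exact mem_wordSpan _ hs
    · rw [algStar_mul_algLetter_ne S K hzy, zero_mul, zero_mul]
      exact zero_mem _
  refine map_mem_of_mem_wordSpan
    (LinearMap.mulLeft K (S.algStar K y) ∘ₗ LinearMap.mulRight K (S.algLetter K x))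
    (fun u s hs => ?_) ha
  rw [LinearMap.comp_apply, LinearMap.mulLeft_apply, LinearMap.mulRight_apply, mul_assoc,
    algElt_mul_algLetter, ← mul_assoc (S.algWord K u)]
  have h : S.algWord K u * S.algLetter K (S.letter s x) = S.algWord K (u ++ [S.letter s x]) := by
    rw [algWord_append, algWord_cons, algWord_nil, mul_one]
  rw [h]
  cases u with
  | nil => exact key _ _ _ (hsec s hs x)
  | cons z u => exact key _ _ _ (hsec s hs x)

/-- Moving `s` past a word leaves a product of two elements of `N`; the extra letter `x` replaces it
by one of its sections, which lies in `N`. -/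
theorem algElt_mul_mul_algLetter_mem_wordSpan (hsec : ∀ s ∈ N, ∀ x, S.sect s x ∈ N)
    (hmul : ∀ s ∈ N, ∀ t ∈ N, ∀ x, S.sect (s * t) x ∈ N) (x : X)
    {s : S.carrier} (hs : s ∈ N) {a : NekrashevychAlgebra K S} (ha : a ∈ S.wordSpan K N) :
    S.algElt K s * (a * S.algLetter K x) ∈ S.wordSpan K N := by
  refine map_mem_of_mem_wordSpan
    (LinearMap.mulLeft K (S.algElt K s) ∘ₗ LinearMap.mulRight K (S.algLetter K x))
    (fun u t ht => ?_) ha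
  obtain ⟨u', s', hs', h⟩ := exists_algElt_mul_algWord (K := K) hsec u hs
  rw [LinearMap.comp_apply, LinearMap.mulLeft_apply, LinearMap.mulRight_apply, mul_assoc,
    ← mul_assoc, h, mul_assoc, ← mul_assoc (S.algElt K s'), ← map_mul, algElt_mul_algLetter,
    ← mul_assoc]
  have h : S.algWord K u' * S.algLetter K (S.letter (s' * t) x)
      = S.algWord K (u' ++ [S.letter (s' * t) x]) := by
    rw [algWord_append, algWord_cons, algWord_nil, mul_one]
  rw [h]
  exact mem_wordSpan _ (hmul _ hs' _ ht x)

variable (S K N) in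
/-- The elements `a` such that `a v` is in `wordSpan` for all long words `v`. -/
noncomputable def eventualSpan : Submodule K (NekrashevychAlgebra K S) where
  carrier := {a | ∃ n : ℕ, ∀ v : List X, n ≤ v.length → a * S.algWord K v ∈ S.wordSpan K N}
  zero_mem' := ⟨0, fun v _ => by rw [zero_mul]; exact zero_mem _⟩
  add_mem' := by
    rintro a b ⟨m, hm⟩ ⟨n, hn⟩
    refine ⟨max m n, fun v hv => ?_⟩
    rw [add_mul]
    exact add_mem (hm v ((le_max_left _ _).trans hv)) (hn v ((le_max_right _ _).trans hv))
  smul_mem' := by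
    rintro c a ⟨m, hm⟩
    refine ⟨m, fun v hv => ?_⟩
    rw [smul_mul_assoc]
    exact Submodule.smul_mem _ _ (hm v hv)

theorem mul_mem_eventualSpan (b : NekrashevychAlgebra K S)
    (hb : ∀ a ∈ S.wordSpan K N, ∀ x, b * (a * S.algLetter K x) ∈ S.wordSpan K N)
    {a : NekrashevychAlgebra K S} (ha : a ∈ S.eventualSpan K N) : b * a ∈ S.eventualSpan K N := by
  obtain ⟨n, hn⟩ := ha
  refine ⟨n + 1, fun v hv => ?_⟩
  obtain ⟨w, x, rfl⟩ : ∃ w x, v = w ++ [x] := by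
    rcases List.eq_nil_or_concat v with rfl | ⟨w, x, rfl⟩
    · simp at hv
    · exact ⟨w, x, by simp⟩
  rw [algWord_append, algWord_cons, algWord_nil, mul_one, mul_assoc, ← mul_assoc a]
  exact hb _ (hn w (by simpa using hv)) x

/-- The elements whose left multiplication preserves `eventualSpan` form a subalgebra. It contains
all generators, each costing one more letter of `v`, and `1` is in `eventualSpan`. -/
theorem mem_eventualSpan (h1 : 1 ∈ N) (hsec : ∀ s ∈ N, ∀ x, S.sect s x ∈ N)
    (hmul : ∀ s ∈ N, ∀ t ∈ N, ∀ x, S.sect (s * t) x ∈ N) (hgen : Submonoid.closure N = ⊤)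
    (a : NekrashevychAlgebra K S) : a ∈ S.eventualSpan K N := by
  let B : Subalgebra K (NekrashevychAlgebra K S) :=
    { carrier := {b | ∀ a ∈ S.eventualSpan K N, b * a ∈ S.eventualSpan K N}
      mul_mem' := fun {b c} hb hc a ha => by rw [mul_assoc]; exact hb _ (hc _ ha)
      add_mem' := fun {b c} hb hc a ha => by rw [add_mul]; exact add_mem (hb _ ha) (hc _ ha)
      algebraMap_mem' := fun k a ha => by
        rw [← Algebra.smul_def]; exact Submodule.smul_mem _ _ ha }
  have hB : B = ⊤ := by
    refine S.subalgebra_eq_top K B (fun x a ha => ?_) (fun x a ha => ?_) (fun g => ?_)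
    · refine mul_mem_eventualSpan _ (fun a ha y => algLetter_mul_mem_wordSpan x ?_) ha
      have := mul_algWord_mem_wordSpan hsec [y] ha
      rwa [algWord_cons, algWord_nil, mul_one] at this
    · exact mul_mem_eventualSpan _
        (fun a ha y => algStar_mul_mul_algLetter_mem_wordSpan hsec x y ha) ha
    · have hg : g ∈ Submonoid.closure N := hgen ▸ Submonoid.mem_top g
      have hle : Submonoid.closure N ≤ B.toSubmonoid.comap (S.algElt K) :=
        Submonoid.closure_le.2 fun s hs a ha => mul_mem_eventualSpan _
          (fun a ha x => algElt_mul_mul_algLetter_mem_wordSpan hsec hmul x hs ha) ha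
      exact hle hg
  have h1' : (1 : NekrashevychAlgebra K S) ∈ S.eventualSpan K N :=
    ⟨0, fun v _ => by simpa using mem_wordSpan (K := K) v h1⟩
  have ha : a ∈ B := hB ▸ Algebra.mem_top
  simpa using ha 1 h1'

/-- A criterion for simplicity: the group has a nucleus `N` whose elements have trivial sections at
some word `v` and are determined by their values at `v`. -/
theorem isSimpleRing_nekrashevychAlgebra [Nontrivial X] (h1 : 1 ∈ N)
    (hsec : ∀ s ∈ N, ∀ x, S.sect s x ∈ N)
    (hmul : ∀ s ∈ N, ∀ t ∈ N, ∀ x, S.sect (s * t) x ∈ N) (hgen : Submonoid.closure N = ⊤)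
    (v : List X)
    (hv : ∀ s ∈ N, ∀ w,
      (s : Equiv.Perm (List X)) (v ++ w) = (s : Equiv.Perm (List X)) v ++ w)
    (hinj : ∀ s ∈ N, ∀ t ∈ N,
      (s : Equiv.Perm (List X)) v = (t : Equiv.Perm (List X)) v → s = t) :
    IsSimpleRing (NekrashevychAlgebra K S) := by
  have hnt := nontrivial_quotient_shortSupport (X := X) K Unit
  let _ : MulAction S.carrier Unit :=
    { smul := fun _ y => y, one_smul := fun _ => rfl, mul_smul := fun _ _ _ => rfl }
  have : Nontrivial (NekrashevychAlgebra K S) := (S.rep K Unit).toRingHom.domain_nontrivial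
  refine IsSimpleRing.of_eq_bot_or_eq_top fun I => or_iff_not_imp_left.2 fun hI => ?_
  obtain ⟨a, haI, ha0⟩ : ∃ a ∈ I, a ≠ 0 := by
    obtain ⟨a, ha, h0⟩ := SetLike.exists_of_lt (bot_lt_iff_ne_bot.2 hI)
    exact ⟨a, ha, h0⟩
  obtain ⟨n, hn⟩ := mem_eventualSpan (K := K) h1 hsec hmul hgen a
  obtain ⟨z, hz, haz⟩ : ∃ z : List X, z.length = n ∧ a * S.algWord K z ≠ 0 := by
    by_contra! h
    exact ha0 (S.eq_zero_of_mul_algWord K n h)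
  have hmem := hn z hz.ge
  rw [wordSpan, ← Finsupp.range_linearCombination] at hmem
  obtain ⟨c, hc⟩ := hmem
  have hc0 : c ≠ 0 := by
    rintro rfl
    exact haz (by rw [← hc, map_zero])
  -- Right multiplication by `v` turns `u s` into the word `u s(v)`. Since `s(v)` has the length of
  -- `v`, both `u` and `s(v)` can be read off, so no terms merge.
  let φ : List X × N → List X := fun us => us.1 ++ (us.2 : S.carrier).1 v
  have hφ : Function.Injective φ := by
    rintro ⟨u, s⟩ ⟨u', s'⟩ h
    have hl : ((s : S.carrier).1 v).length = ((s' : S.carrier).1 v).length := by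
      rw [S.length_apply _ s.1.2, S.length_apply _ s'.1.2]
    obtain ⟨rfl, h2⟩ := List.append_inj' h hl
    rw [Subtype.ext (hinj s s.2 s' s'.2 h2)]
  have hcv : a * S.algWord K z * S.algWord K v =
      Finsupp.linearCombination K (S.algWord K) (c.mapDomain φ) := by
    rw [Finsupp.linearCombination_mapDomain, ← hc, Finsupp.linearCombination_apply,
      Finsupp.linearCombination_apply, Finsupp.sum, Finsupp.sum, Finset.sum_mul]
    refine Finset.sum_congr rfl fun us _ => ?_
    rw [smul_mul_assoc, mul_assoc, algElt_mul_algWord S K v _ (hv _ us.2.2), ← algWord_append]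
    rfl
  obtain ⟨k, hk, b, b', hb⟩ := S.exists_mul_linearCombination_mul K (c := c.mapDomain φ)
    fun h => hc0 (Finsupp.mapDomain_injective hφ (by rw [h, Finsupp.mapDomain_zero]))
  rw [← hcv] at hb
  have hkI : algebraMap K (NekrashevychAlgebra K S) k ∈ I := by
    rw [← hb]
    exact I.mul_mem_right _ _ (I.mul_mem_left _ _ (I.mul_mem_right _ _ (I.mul_mem_right _ _ haI)))
  rw [← I.one_mem_iff]
  have := I.mul_mem_left (algebraMap K _ k⁻¹) _ hkI
  rwa [← map_mul, inv_mul_cancel₀ hk, map_one] at this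

end Simple

/-- An obstruction to simplicity: a nonzero combination of group elements that acts as zero on
functions on words, where the group elements involved are their own sections at a fixed letter. -/
theorem not_isSimpleRing_nekrashevychAlgebra {X : Type*} [Fintype X] [Nonempty X]
    (S : SelfSimilarGroup X) (K : Type*) [Field K] {ι : Type*} [Fintype ι] (γ : ι → S.carrier)
    (hγ : Function.Injective γ) (x : X) (hl : ∀ i, S.letter (γ i) x = x)
    (hs : ∀ i, S.sect (γ i) x = γ i) (c : ι → K) (hc : c ≠ 0)
    (hsum : ∀ (w : List X) (f : List X → K),
      ∑ i, c i * f (((γ i)⁻¹ : S.carrier).1 w) = 0) :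
    ¬ IsSimpleRing (NekrashevychAlgebra K S) := by
  intro _
  have hnt := nontrivial_quotient_shortSupport (X := X) K Unit
  -- Over a one-point set, the representation is the action on functions of words.
  let _ : MulAction S.carrier Unit :=
    { smul := fun _ y => y, one_smul := fun _ => rfl, mul_smul := fun _ _ _ => rfl }
  have hinj : Function.Injective (S.rep K Unit) := (S.rep K Unit).toRingHom.injective
  have hfst : ∀ (w : List X) (g : S.carrier) (y : Unit),
      (S.pairAct g w y).1 = (g : Equiv.Perm (List X)) w := by
    intro w
    induction w with
    | nil => exact fun g y => (List.length_eq_zero_iff.1 (S.length_apply g g.2 [])).symm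
    | cons x w ih => intro g y; rw [S.apply_cons, ← ih _ y]; rfl
  have hzero : ∑ i, c i • S.algElt K (γ i) = 0 := by
    apply hinj
    rw [map_zero]
    refine Submodule.linearMap_qext _ (LinearMap.ext fun f => ?_)
    rw [LinearMap.comp_apply, rep_sum_smul_algElt, LinearMap.comp_apply, LinearMap.zero_apply]
    have h0 : ∑ i, c i • S.opElt K Unit (γ i) f = 0 := by
      funext w y
      simpa [Finset.sum_apply, opElt, hfst] using hsum w fun w => f w ()
    rw [h0, map_zero]
  obtain ⟨j, hj⟩ := Function.ne_iff.1 hc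
  have hrep : ∀ (n : ℕ) (i : ι) (h : S.carrier),
      S.pairAct (γ i)⁻¹ (List.replicate n x) h = (List.replicate n x, (γ i)⁻¹ * h) := by
    intro n i h
    have h1 : S.letter (γ i)⁻¹ x = x := by
      conv_lhs => rw [← hl i]
      rw [← letter_mul, inv_mul_cancel, letter_one]
    have h2 : S.sect (γ i)⁻¹ x = (γ i)⁻¹ := by
      have := S.sect_mul (γ i)⁻¹ (γ i) x
      rw [inv_mul_cancel, sect_one, hl, hs] at this
      exact eq_inv_of_mul_eq_one_left this.symm
    induction n with
    | zero => rfl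
    | succ n ih => simp [List.replicate_succ, pairAct, h1, h2, ih]
  classical
  -- Here the group acts on itself by left multiplication. At `(x^n, γ j)` only the term `i = j`
  -- survives, so a vanishing combination would give `c j = 0`.
  let f : List X → S.carrier → K := fun _ h => if h = 1 then 1 else 0
  have hf := LinearMap.congr_fun (congrArg (S.rep K S.carrier) hzero)
    ((shortSupport X K S.carrier).mkQ f)
  rw [rep_sum_smul_algElt, map_zero, LinearMap.zero_apply, Submodule.mkQ_apply, Submodule.Quotient.mk_eq_zero] at hf
  obtain ⟨n, hn⟩ := hf
  have := hn (List.replicate n x) (γ j) (by simp)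
  simp only [Finset.sum_apply, Pi.smul_apply, opElt, LinearMap.coe_mk, AddHom.coe_mk, hrep,
    f, inv_mul_eq_one, hγ.eq_iff, smul_eq_mul, mul_ite, mul_one, mul_zero, Finset.sum_ite_eq',
    Finset.mem_univ, if_true] at this
  exact hj this

end SelfSimilarGroup

/-! ### The nucleus of a multispinal group, and the criteria applied to it -/

namespace MultispinalData

variable {G H X : Type*} [Group G] [Finite G] [Group H] [Finite H] [Finite X] [MulAction H X]
  (D : MultispinalData G H X)

/-- The element `g ∈ G` of the multispinal group. -/
def ofG (g : G) : D.group.carrier :=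
  ⟨D.permG g, Subgroup.subset_closure (Or.inl ⟨g, rfl⟩)⟩

/-- The element `h ∈ H` of the multispinal group. -/
def ofH (h : H) : D.group.carrier :=
  ⟨permH h, Subgroup.subset_closure (Or.inr ⟨h, rfl⟩)⟩

theorem ofG_mul (g k : G) : D.ofG (g * k) = D.ofG g * D.ofG k :=
  Subtype.ext (Equiv.ext fun w => D.actG_mul g k w)

theorem ofH_mul (h k : H) : D.ofH (h * k) = D.ofH h * D.ofH k :=
  Subtype.ext (Equiv.ext fun w => actH_mul h k w)

theorem ofG_one : D.ofG 1 = 1 :=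
  Subtype.ext (Equiv.ext fun w => D.actG_one w)

theorem ofH_one : D.ofH 1 = 1 :=
  Subtype.ext (Equiv.ext fun w => actH_one w)

theorem ofG_inv (g : G) : (D.ofG g)⁻¹ = D.ofG g⁻¹ := by
  rw [inv_eq_iff_mul_eq_one, ← ofG_mul, mul_inv_cancel, ofG_one]

theorem ofH_inv (h : H) : (D.ofH h)⁻¹ = D.ofH h⁻¹ := by
  rw [inv_eq_iff_mul_eq_one, ← ofH_mul, mul_inv_cancel, ofH_one]

theorem letter_ofH (h : H) (x : X) : D.group.letter (D.ofH h) x = h • x :=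
  (D.group.letter_sect_unique (g := D.ofH h) (h := 1) fun _ => rfl).1

theorem sect_ofH (h : H) (x : X) : D.group.sect (D.ofH h) x = 1 :=
  Subtype.ext (D.group.letter_sect_unique (g := D.ofH h) (h := 1) fun _ => rfl).2

theorem letter_ofG (g : G) (x : X) : D.group.letter (D.ofG g) x = x := by
  cases hx : D.Φ x with
  | inl α => exact (D.group.letter_sect_unique (g := D.ofG g) (y := x) (h := D.permG (α g)) fun w => by
      simp [ofG, permG, actG, hx]).1
  | inr l => exact (D.group.letter_sect_unique (g := D.ofG g) (y := x) (h := permH (l g)) fun w => by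
      simp [ofG, permG, permH, actG, hx]).1

theorem sect_ofG_inl {x : X} {α : MulAut G} (hx : D.Φ x = Sum.inl α) (g : G) :
    D.group.sect (D.ofG g) x = D.ofG (α g) :=
  Subtype.ext (D.group.letter_sect_unique (g := D.ofG g) (y := x) (h := D.permG (α g)) fun w => by
    simp [ofG, permG, actG, hx]).2

theorem sect_ofG_inr {x : X} {l : G →* H} (hx : D.Φ x = Sum.inr l) (g : G) :
    D.group.sect (D.ofG g) x = D.ofH (l g) :=
  Subtype.ext (D.group.letter_sect_unique (g := D.ofG g) (y := x) (h := permH (l g)) fun w => by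
    simp [ofG, permG, permH, actG, hx]).2

/-- The nucleus `G ∪ H` of the multispinal group. -/
def nucleus : Set D.group.carrier := Set.range D.ofG ∪ Set.range D.ofH

theorem ofG_mem_nucleus (g : G) : D.ofG g ∈ D.nucleus := Or.inl ⟨g, rfl⟩

theorem ofH_mem_nucleus (h : H) : D.ofH h ∈ D.nucleus := Or.inr ⟨h, rfl⟩

theorem one_mem_nucleus : 1 ∈ D.nucleus := D.ofG_one ▸ D.ofG_mem_nucleus 1

theorem sect_ofG_mem_nucleus (g : G) (x : X) : D.group.sect (D.ofG g) x ∈ D.nucleus := by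
  cases hx : D.Φ x with
  | inl α => rw [D.sect_ofG_inl hx]; exact D.ofG_mem_nucleus _
  | inr l => rw [D.sect_ofG_inr hx]; exact D.ofH_mem_nucleus _

theorem sect_mem_nucleus : ∀ s ∈ D.nucleus, ∀ x, D.group.sect s x ∈ D.nucleus := by
  rintro _ (⟨g, rfl⟩ | ⟨h, rfl⟩) x
  · exact D.sect_ofG_mem_nucleus g x
  · rw [sect_ofH]; exact D.one_mem_nucleus

/-- Elements of `H` have trivial sections, so a mixed product has the sections of its factor from
`G`; the other products stay in `G` or in `H`. -/
theorem sect_mul_mem_nucleus :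
    ∀ s ∈ D.nucleus, ∀ t ∈ D.nucleus, ∀ x, D.group.sect (s * t) x ∈ D.nucleus := by
  rintro _ (⟨g, rfl⟩ | ⟨h, rfl⟩) _ (⟨g', rfl⟩ | ⟨h', rfl⟩) x
  · rw [← ofG_mul]; exact D.sect_ofG_mem_nucleus _ x
  · rw [SelfSimilarGroup.sect_mul, sect_ofH, mul_one]; exact D.sect_ofG_mem_nucleus _ _
  · rw [SelfSimilarGroup.sect_mul, sect_ofH, one_mul]; exact D.sect_ofG_mem_nucleus _ _
  · rw [← ofH_mul, sect_ofH]; exact D.one_mem_nucleus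

theorem closure_nucleus : Submonoid.closure D.nucleus = ⊤ := by
  -- Carrying inverses through the induction passes from the generated subgroup to the generated
  -- submonoid.
  have key : ∀ g (hg : g ∈ D.group.carrier), (⟨g, hg⟩ : D.group.carrier) ∈
      Submonoid.closure D.nucleus ∧ (⟨g, hg⟩⁻¹ : D.group.carrier) ∈ Submonoid.closure D.nucleus := by
    intro g hg
    induction hg using Subgroup.closure_induction with
    | mem a ha =>
      rcases ha with ⟨g, rfl⟩ | ⟨h, rfl⟩
      · refine ⟨Submonoid.subset_closure (D.ofG_mem_nucleus g), ?_⟩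
        change (D.ofG g)⁻¹ ∈ _
        rw [ofG_inv]
        exact Submonoid.subset_closure (D.ofG_mem_nucleus _)
      · refine ⟨Submonoid.subset_closure (D.ofH_mem_nucleus h), ?_⟩
        change (D.ofH h)⁻¹ ∈ _
        rw [ofH_inv]
        exact Submonoid.subset_closure (D.ofH_mem_nucleus _)
    | one => exact ⟨one_mem _, (inv_one (G := D.group.carrier)).symm ▸ one_mem _⟩
    | mul a b ha hb iha ihb =>
      refine ⟨mul_mem iha.1 ihb.1, ?_⟩
      have := mul_mem ihb.2 iha.2
      rwa [← mul_inv_rev] at this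
    | inv a ha iha => exact ⟨iha.2, (inv_inv (⟨a, ha⟩ : D.group.carrier)).symm ▸ iha.1⟩
  exact top_le_iff.1 fun g _ => (key g g.2).1

/-- If some `Φ(x)` is an injective homomorphism `G → H`, then the Nekrashevych algebra is simple. -/
theorem isSimpleRing_of_injective [Fintype X] [Nontrivial X] (K : Type*) [Field K] {x : X}
    {l : G →* H} (hx : D.Φ x = Sum.inr l) (hl : Function.Injective l) :
    IsSimpleRing (NekrashevychAlgebra K D.group) := by
  have hG : ∀ g w, (D.ofG g).1 (x :: w) = x :: actH (l g) w := fun g w => by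
    simp [ofG, permG, actG, hx]
  have hH : ∀ h (y : X) w, (D.ofH h).1 (y :: w) = (h • y) :: w := fun _ _ _ => rfl
  have hfree : ∀ {h k : H} {y : X}, h • y = k • y → h = k := fun {h k y} e =>
    (inv_mul_eq_one.1 (D.free (k⁻¹ * h) y (by rw [mul_smul, e, inv_smul_smul]))).symm
  -- `g` fixes the first letter and `h` the second, so equal values make `h` and `l g` fix `x`; by
  -- freeness both are trivial.
  have hmix : ∀ g h, (D.ofG g).1 [x, x] = (D.ofH h).1 [x, x] → D.ofG g = D.ofH h := by
    intro g h e
    rw [hG, hH, actH] at e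
    simp only [List.cons.injEq, and_true] at e
    obtain rfl : h = 1 := D.free h x e.1.symm
    have : l g = 1 := D.free _ x e.2
    rw [hl (this.trans (map_one l).symm), ofG_one, ofH_one]
  -- The first `x` turns `g` into `l g ∈ H`; the second exposes `l g` through the free action and
  -- leaves a trivial section.
  refine SelfSimilarGroup.isSimpleRing_nekrashevychAlgebra D.one_mem_nucleus D.sect_mem_nucleus
    D.sect_mul_mem_nucleus D.closure_nucleus [x, x] ?_ ?_
  · rintro _ (⟨g, rfl⟩ | ⟨h, rfl⟩) w
    · rw [List.cons_append, hG, hG]; rfl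
    · rw [List.cons_append, hH, hH]; rfl
  · rintro _ (⟨g, rfl⟩ | ⟨h, rfl⟩) _ (⟨g', rfl⟩ | ⟨h', rfl⟩) e
    · rw [hG, hG, actH, actH] at e
      simp only [List.cons.injEq, and_true, true_and] at e
      rw [hl (hfree e)]
    · exact hmix g h' e
    · exact (hmix g' h e.symm).symm
    · rw [hH, hH] at e
      simp only [List.cons.injEq, and_true] at e
      rw [hfree e]

/-- If a nonzero element of `K[G]` maps to zero under all homomorphisms `Φ(x) : G → H`, and `Φ(x)`
is otherwise the identity, then the Nekrashevych algebra is not simple. -/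
theorem not_isSimpleRing_of_sum_eq_zero [Fintype X] [Fintype G] (K : Type*) [Field K]
    (hid : ∀ x α, D.Φ x = Sum.inl α → α = 1) (c : G → K) (hc : c ≠ 0)
    (hsum : ∀ x l, D.Φ x = Sum.inr l → ∀ F : H → K, ∑ g, c g * F (l g) = 0) :
    ¬ IsSimpleRing (NekrashevychAlgebra K D.group) := by
  obtain ⟨x, α, hα⟩ := D.exists_aut
  obtain rfl := hid x α hα
  have : Nonempty X := ⟨x⟩
  have hinj : Function.Injective D.ofG := by
    intro g g' e
    refine (inv_mul_eq_one.1 (D.separates (g'⁻¹ * g) ?_)).symm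
    rintro l β ⟨y, hy⟩ hβ
    -- All automorphisms among the `Φ(x)` are trivial, so `separates` only involves the kernels of
    -- the homomorphisms themselves.
    have hβ1 : β ∈ (⊥ : Subgroup (MulAut G)) :=
      (Subgroup.closure_le _).2 (by rintro γ ⟨z, hz⟩; exact hid z γ hz) hβ
    rw [Subgroup.mem_bot.1 hβ1, MulAut.one_apply]
    have e1 : D.ofG (g'⁻¹ * g) = 1 := by rw [ofG_mul, e, ← ofG_mul, inv_mul_cancel, ofG_one]
    have e2 := D.sect_ofG_inr hy (g'⁻¹ * g)
    rw [e1, SelfSimilarGroup.sect_one] at e2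
    have e3 := D.letter_ofH (l (g'⁻¹ * g)) y
    rw [← e2, SelfSimilarGroup.letter_one] at e3
    exact D.free _ y e3.symm
  refine D.group.not_isSimpleRing_nekrashevychAlgebra K D.ofG hinj x (fun g => D.letter_ofG g x)
    (fun g => by rw [D.sect_ofG_inl hα]; rfl) c hc fun w => ?_
  obtain ⟨y, l, hl⟩ := D.exists_hom
  induction w with
  | nil =>
    intro f
    have h : ∀ g, (((D.ofG g)⁻¹ : D.group.carrier).1 []) = [] := fun g =>
      List.length_eq_zero_iff.1 (D.group.length_apply _ ((D.ofG g)⁻¹).2 [])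
    simp only [h]
    -- At the empty word only `∑ c g = 0` is needed; it follows from a constant `F` and the
    -- existence of one homomorphism `Φ(y)`.
    exact hsum y l hl fun _ => f []
  | cons z w ih =>
    intro f
    simp only [D.ofG_inv, D.group.apply_cons, letter_ofG] at ih ⊢
    cases hz : D.Φ z with
    | inl β =>
      simp only [D.sect_ofG_inl hz, hid z β hz, MulAut.one_apply]
      -- Under an identity letter the same combination acts on the shorter word; under a
      -- homomorphism letter the sum factors through `H` and vanishes at once.
      exact ih fun w => f (z :: w)
    | inr l' =>
      simp only [D.sect_ofG_inr hz, map_inv]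
      exact hsum z l' hz fun h => f (z :: (D.ofH h⁻¹).1 w)

end MultispinalData

/-! ### Multi-edge spinal groups -/

theorem multiEdgeHom_injective {p : ℕ} [Fact p.Prime] (e : Fin 1 → Fin (p - 1) → ZMod p)
    {k : Fin (p - 1)} (hk : e 0 k ≠ 0) : Function.Injective (multiEdgeHom e k) := by
  refine (injective_iff_map_eq_one _).2 fun v hv => ?_
  have h : ∑ i, v.toAdd i * e i k = 0 := hv
  rw [Fin.sum_univ_one, mul_eq_zero, or_iff_left hk] at h
  refine Multiplicative.toAdd.injective (funext fun i => ?_)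
  rw [Subsingleton.elim i 0, h]
  rfl

/-- For `r ≥ 2`, the homomorphisms `K[(ℤ/p)^r] → K[ℤ/p]` have a common kernel. -/
theorem exists_sum_multiEdgeHom_eq_zero {p r : ℕ} [Fact p.Prime] (hr : 2 ≤ r)
    (e : Fin r → Fin (p - 1) → ZMod p) (K : Type*) [Field K] :
    ∃ c : Multiplicative (Fin r → ZMod p) → K, c ≠ 0 ∧
      ∀ k (F : Multiplicative (ZMod p) → K), ∑ g, c g * F (multiEdgeHom e k g) = 0 := by
  classical
  -- `T` collects the pushforwards `K[G] → K[H]` along all `multiEdgeHom e k`. Its source has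
  -- dimension `p ^ r` and its target `(p - 1) * p`.
  let T : (Multiplicative (Fin r → ZMod p) → K) →ₗ[K]
      (Fin (p - 1) × Multiplicative (ZMod p) → K) :=
    { toFun := fun c kh => ∑ g, if multiEdgeHom e kh.1 g = kh.2 then c g else 0
      map_add' := fun c d => by
        funext kh
        simp only [Pi.add_apply, ← Finset.sum_add_distrib, ite_add_ite, add_zero]
      map_smul' := fun a c => by
        funext kh
        simp only [Pi.smul_apply, smul_eq_mul, RingHom.id_apply, Finset.mul_sum, mul_ite,
          mul_zero] }
  have hp : 0 < p := (Fact.out : p.Prime).pos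
  have hT : LinearMap.ker T ≠ ⊥ := by
    apply LinearMap.ker_ne_bot_of_finrank_lt
    rw [Module.finrank_fintype_fun_eq_card, Module.finrank_fintype_fun_eq_card, Fintype.card_prod,
      Fintype.card_multiplicative, Fintype.card_multiplicative, Fintype.card_fun, ZMod.card,
      Fintype.card_fin, Fintype.card_fin]
    calc (p - 1) * p < p * p := Nat.mul_lt_mul_of_pos_right (by omega) hp
      _ = p ^ 2 := (sq p).symm
      _ ≤ p ^ r := Nat.pow_le_pow_right hp hr
  obtain ⟨c, hc, hc0⟩ := Submodule.exists_mem_ne_zero_of_ne_bot hT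
  refine ⟨c, hc0, fun k F => ?_⟩
  have h : ∀ h, (∑ g, if multiEdgeHom e k g = h then c g else 0) = 0 := fun h =>
    congrFun (LinearMap.mem_ker.1 hc) (k, h)
  calc ∑ g, c g * F (multiEdgeHom e k g)
      = ∑ g, ∑ h, (if multiEdgeHom e k g = h then c g else 0) * F h := by
        simp only [ite_mul, zero_mul, Finset.sum_ite_eq, Finset.mem_univ, if_true]
    _ = ∑ h, (∑ g, if multiEdgeHom e k g = h then c g else 0) * F h := by
        rw [Finset.sum_comm]
        simp only [Finset.sum_mul]
    _ = 0 := by simp only [h, zero_mul, Finset.sum_const_zero]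

theorem mainTheorem8 (p : ℕ) [Fact p.Prime] (r : ℕ) (e : Fin r → Fin (p - 1) → ZMod p)
    (he : LinearIndependent (ZMod p) e) :
    (r = 1 → ∀ (K : Type*) [Field K],
      IsSimpleRing (NekrashevychAlgebra K (multiEdgeSpinalGroup e he))) ∧
    (2 ≤ r → ∀ (K : Type*) [Field K],
      ¬ IsSimpleRing (NekrashevychAlgebra K (multiEdgeSpinalGroup e he))) := by
  constructor
  · rintro rfl K _
    -- The single vector `e 0` has a nonzero coordinate `k`, which makes `Φ(k)` injective.
    obtain ⟨k, hk⟩ := Function.ne_iff.1 (he.ne_zero 0)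
    have hkv : ((k : ℕ) : ZMod p).val = k := by
      rw [ZMod.val_natCast, Nat.mod_eq_of_lt (by omega)]
    refine (multiEdgeData e he).isSimpleRing_of_injective K (x := ((k : ℕ) : ZMod p))
      (l := multiEdgeHom e k) ?_ (multiEdgeHom_injective e hk)
    simp [multiEdgeData, hkv]
  · intro hr K _
    obtain ⟨c, hc, hsum⟩ := exists_sum_multiEdgeHom_eq_zero hr e K
    refine (multiEdgeData e he).not_isSimpleRing_of_sum_eq_zero K ?_ c hc ?_
    · intro x α hx
      simp only [multiEdgeData] at hx
      split_ifs at hx with h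
      exact (Sum.inl.inj hx).symm
    · intro x l hx F
      simp only [multiEdgeData] at hx
      split_ifs at hx with h
      rw [← Sum.inr.inj hx]
      exact hsum _ F
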